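/- Assume $\mathsf{BQP}\nsubseteq\mathsf{P/poly}$. Then there exist, for every $d\in\mathbb N$, a compact set $\mathcal X_d\subseteq[0,1]^d\subset\mathbb R^d$ with non-empty interior and a continuous function $f_d\colon\mathcal X_d\to[0,1]^d$ with the following two properties. 1. The sequence $(f_d)_d$ can be $\varepsilon$-approximated quantum efficiently in $d$ and $1/\varepsilon$: there are a polynomial $p$ and a deterministic Turing machine that, on input $(1^d,1^m)$, $m\ge1$, writes down in time polynomial in $d+m$ a quantum circuit over the gate set $\{H,T,\mathrm{CNOT}\}$ which, for almost every $x\in\mathcal X_d$ (with respect to Lebesgue measure), given the first $p(d+m)$ binary digits of each coordinate of $x$, outputs (in binary) a point $y\in[0,1]^d$ with $\lVert y-f_d(x)\rVert\le 1/m$ with probability at least $2/3$. 2. The composition kernels $$k_{f_d}(x,x')=\exp\left(-\lVert f_d(x)-f_d(x')\rVert^2\right),\qquad x,x'\in\mathcal X_d,$$ cannot be $\varepsilon$-approximated classically efficiently in $d$: there is $\varepsilon_0>0$ such that for no $\varepsilon\in(0,\varepsilon_0]$ there is a family of randomized Boolean circuits $(C_d)_d$ (not necessarily uniform), of size polynomial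 in $d$, such that for every $d$ and almost every $(x,x')\in\mathcal X_d\times\mathcal X_d$ the circuit $C_d$, given polynomially many (in $d$) binary digits of the coordinates of $x$ and $x'$ and polynomially many uniformly random bits, outputs (in binary) a number within distance $\varepsilon$ of $k_{f_d}(x,x')$ with probability at least $2/3$. Here $\lVert\cdot\rVert$ is the Euclidean norm, $\mathsf{BQP}$ is the class of languages decided with error at most $1/3$ by polynomial-time uniform families of quantum circuits, and $\mathsf{P/poly}$ is the class of languages decided by Boolean circuits of polynomial size. -/

import Mathlib

open MeasureTheory

/-! ### Quantum circuits over the gate set {H, T, CNOT} -/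

/-- Gates, acting on qubits named by natural numbers. -/
inductive QGate where
  | h (i : ℕ)
  | t (i : ℕ)
  | cnot (c i : ℕ)

/-- A quantum circuit: `width` qubits, a list of gates (applied from left to right), and the size
`out` of the output register, which consists of the first `out` qubits. -/
structure QCircuit where
  width : ℕ
  out : ℕ
  gates : List QGate

/-- Action of a gate on the amplitudes of a `w`-qubit state in the computational basis.
A gate that names a qubit outside the register, or whose control is its target, does nothing. -/
noncomputable def QGate.apply {w : ℕ} (g : QGate) (ψ : (Fin w → Bool) → ℂ) :
    (Fin w → Bool) → ℂ :=
  match g with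
  | .h i =>
    if hi : i < w then
      fun b => ((if b ⟨i, hi⟩ then -ψ b else ψ b)
        + ψ (Function.update b ⟨i, hi⟩ (!b ⟨i, hi⟩))) / (Real.sqrt 2 : ℂ)
    else ψ
  | .t i =>
    if hi : i < w then
      fun b => if b ⟨i, hi⟩ then Complex.exp (Complex.I * Real.pi / 4) * ψ b else ψ b
    else ψ
  | .cnot c i =>
    if hi : c < w ∧ i < w ∧ c ≠ i then
      fun b => ψ (Function.update b ⟨i, hi.2.1⟩ (xor (b ⟨i, hi.2.1⟩) (b ⟨c, hi.1⟩)))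
    else ψ

namespace QCircuit

/-- The initial state: the classical input `x` is loaded on the first qubits, and all the other
qubits are in state `0`. -/
def initState (C : QCircuit) (x : List Bool) : (Fin C.width → Bool) → ℂ :=
  fun b => if b = (fun i : Fin C.width => x.getD i.val false) then 1 else 0

/-- The state at the end of the computation on the classical input `x`. -/
noncomputable def finalState (C : QCircuit) (x : List Bool) : (Fin C.width → Bool) → ℂ :=
  C.gates.foldl (fun ψ g => g.apply ψ) (C.initState x)

/-- The probability (Born rule) that, on the classical input `x`, the measurement of the output
register in the computational basis yields a bit string in `S`. -/
noncomputable def prob (C : QCircuit) (x : List Bool) (S : Set (List Bool)) : ℝ :=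
  ∑ b : Fin C.width → Bool,
    S.indicator (fun _ => ‖C.finalState x b‖ ^ 2) ((List.ofFn b).take C.out)

end QCircuit

/-- Symbols used to write down a quantum circuit. -/
inductive QSymbol where
  | tick
  | sep
  | h
  | t
  | cnot

/-- Description of a gate; qubit numbers are written in unary. -/
def QGate.encode : QGate → List QSymbol
  | .h i => .h :: List.replicate i .tick
  | .t i => .t :: List.replicate i .tick
  | .cnot c i => .cnot :: (List.replicate c .tick ++ .sep :: List.replicate i .tick)

/-- Description of a circuit; the numbers of qubits are written in unary. -/
def QCircuit.encode (C : QCircuit) : List QSymbol :=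
  List.replicate C.width .tick ++ .sep :: (List.replicate C.out .tick ++
    .sep :: C.gates.flatMap QGate.encode)

/-- A family of quantum circuits indexed by `α` is uniform (and of polynomial size) if a
deterministic Turing machine writes down the circuit of index `a` in time polynomial in the length
of the encoding of `a`. -/
def PolyTimeUniform {α Γ : Type} (e : Computability.Encoding α Γ) (C : α → QCircuit) : Prop :=
  Nonempty (Turing.TM2ComputableInPolyTime e.encode QCircuit.encode C)

open Classical in
/-- The class BQP: languages decided with error at most `1/3` by a uniform family of quantum
circuits, the circuit for inputs of length `n` being generated from `n` in unary. -/
def BQP : Set (Language Bool) :=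
  {L | ∃ C : ℕ → QCircuit, PolyTimeUniform Computability.unaryEncodingNat C ∧
    ∀ x : List Bool, 2 / 3 ≤ (C x.length).prob x {[decide (x ∈ L)]}}

/-! ### Boolean circuits -/

/-- Gates of a Boolean circuit, referring to wires by their position. -/
inductive BoolGate where
  | const (b : Bool)
  | not (i : ℕ)
  | and (i j : ℕ)
  | or (i j : ℕ)

/-- The value of a gate, given the values of the earlier wires. -/
def BoolGate.eval (v : List Bool) : BoolGate → Bool
  | .const b => b
  | .not i => !v.getD i false
  | .and i j => v.getD i false && v.getD j false
  | .or i j => v.getD i false || v.getD j false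

/-- A Boolean circuit, as a straight-line program: the first wires carry the input, each gate adds
one wire, and `outputs` lists the wires that carry the output. -/
structure BoolCircuit where
  gates : List BoolGate
  outputs : List ℕ

namespace BoolCircuit

def size (C : BoolCircuit) : ℕ := C.gates.length + C.outputs.length

/-- The values of all wires on the input `x`. -/
def wires (C : BoolCircuit) (x : List Bool) : List Bool :=
  C.gates.foldl (fun v g => v ++ [g.eval v]) x

def eval (C : BoolCircuit) (x : List Bool) : List Bool :=
  C.outputs.map fun i => (C.wires x).getD i false

end BoolCircuit

open Classical in
/-- The class P/poly: languages decided by Boolean circuits of polynomial size. -/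
def PPoly : Set (Language Bool) :=
  {L | ∃ q : Polynomial ℕ, ∀ n : ℕ, ∃ C : BoolCircuit, C.size ≤ q.eval n ∧
    ∀ x : List Bool, x.length = n → C.eval x = [decide (x ∈ L)]}

/-! ### Binary representation of points of the unit cube -/

/-- The cube `[0,1]^d`. -/
def unitCube (d : ℕ) : Set (EuclideanSpace ℝ (Fin d)) :=
  {x | ∀ i, x i ∈ Set.Icc (0 : ℝ) 1}

/-- The `d * p` bits that represent a point of the unit cube to `p` binary digits per coordinate:
coordinate `x i` is rounded down to `0.β₁β₂…βₚ` (and `1` to `0.11…1`); the string lists the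
first digits of all coordinates, then the second digits of all coordinates, and so on. -/
noncomputable def binaryDigits {d : ℕ} (p : ℕ) (x : EuclideanSpace ℝ (Fin d)) : List Bool :=
  (List.range p).flatMap fun j =>
    List.ofFn fun i : Fin d => (min ⌊2 ^ p * x i⌋₊ (2 ^ p - 1)).testBit (p - 1 - j)

/-- The point represented by a bit string of any length, in the same order of digits: bit number
`j * d + i` has weight `2 ^ (-(j + 1))` in coordinate `i`, and missing bits are zero. -/
noncomputable def binaryPoint (d : ℕ) (s : List Bool) : EuclideanSpace ℝ (Fin d) :=
  WithLp.toLp 2 fun i =>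
    ∑ j ∈ Finset.range s.length, if s.getD (j * d + i) false then (1 / 2 : ℝ) ^ (j + 1) else 0

/-! ### Efficient approximation -/

/-- The sequence `f` can be approximated quantum efficiently on the domains `X`: a uniform family
of quantum circuits, generated in time polynomial in `d` and `m`, computes from polynomially many
digits of `x` a random point that is within distance `1 / m` of `f d x` with probability at least
`2/3`, for almost every `x ∈ X d`. -/
def QuantumEfficientlyApproximable (X : ∀ d : ℕ, Set (EuclideanSpace ℝ (Fin d)))
    (f : ∀ d : ℕ, EuclideanSpace ℝ (Fin d) → EuclideanSpace ℝ (Fin d)) : Prop :=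
  ∃ (p : Polynomial ℕ) (C : ℕ × ℕ → QCircuit),
    PolyTimeUniform
      (Computability.encodingProd Computability.unaryEncodingNat Computability.unaryEncodingNat) C ∧
    ∀ d m : ℕ, 1 ≤ m → ∀ᵐ x ∂(volume.restrict (X d)),
      2 / 3 ≤ (C (d, m)).prob (binaryDigits (p.eval (d + m)) x)
        {s | ‖binaryPoint d s - f d x‖ ≤ 1 / (m : ℝ)}

/-- The sequence `k` of functions of two points can be `ε`-approximated classically efficiently in
`d` on the domains `X`: for every `d` there is a classical circuit of size polynomial in `d` that,
from polynomially many digits of `x` and `x'` and polynomially many uniformly random bits, computes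
a number that is within distance `ε` of `k d x x'` with probability at least `2/3`, for almost every
`(x, x') ∈ X d × X d`. The circuit may depend on `d` in an arbitrary way. -/
def ClassicallyEfficientlyApproximable (ε : ℝ) (X : ∀ d : ℕ, Set (EuclideanSpace ℝ (Fin d)))
    (k : ∀ d : ℕ, EuclideanSpace ℝ (Fin d) → EuclideanSpace ℝ (Fin d) → ℝ) : Prop :=
  ∃ q : Polynomial ℕ, ∀ d : ℕ, ∃ (p r : ℕ) (C : BoolCircuit),
    p ≤ q.eval d ∧ r ≤ q.eval d ∧ C.size ≤ q.eval d ∧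
    ∀ᵐ z ∂((volume.restrict (X d)).prod (volume.restrict (X d))),
      2 / 3 ≤ (Nat.card {ω : Fin r → Bool //
        |binaryPoint 1 (C.eval (binaryDigits p z.1 ++ binaryDigits p z.2 ++ List.ofFn ω)) 0
          - k d z.1 z.2| ≤ ε} : ℝ) / 2 ^ r

/-- The Gaussian kernel with `σ² = 1/2`, composed with the pre-processing function `f`. -/
noncomputable def compositionKernel {d : ℕ}
    (f : EuclideanSpace ℝ (Fin d) → EuclideanSpace ℝ (Fin d))
    (x x' : EuclideanSpace ℝ (Fin d)) : ℝ :=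
  Real.exp (-‖f x - f x'‖ ^ 2)

/-! Fix a language `L` in BQP but not in P/poly and hide its membership problem in the kernel. On
`codeDomain d` every coordinate lies in `[0,1/4] ∪ [1/2,3/4]`, so its first binary digit is a
continuous function of the point, and a point encodes a word of length `d`. `membershipMap L d`
sends the point to `0` or to half the first basis vector, according to whether this word is in `L`;
it is locally constant, hence continuous.

Quantum side: one digit per coordinate is exactly the input of the BQP circuit for `L`, and its
one-bit answer represents the value of the map exactly. The accuracy `m` plays no role, so it only
remains to let the machine that generates the circuits skip the second component of its input
(`PolyTimeUniform.comp_fst`).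

Classical side: the kernel is `1` if two words agree on membership and `exp (-1/4) < 4/5` otherwise,
so an approximation within `1/20`, compared with `7/8`, decides agreement. All points of an open
cell have the same first `p` digits, and cells have positive measure; hence a guarantee for almost
every pair covers every pair of words (`three_mul_card_wrong_le`). With the second word fixed,
Adleman's argument hardwires random strings and a majority vote (`exists_list_countP_lt`,
`Computes.threshold`). This puts `L` in P/poly, a contradiction. -/

/-! ### Restricting the input of a Turing machine to the first component of a pair -/

namespace Turing.TM2

variable {K Λ σ Δ : Type} {Γ : K → Type}

/-- Stacks of a machine, extended by an additional input stack. -/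
abbrev ExtStack (Γ : K → Type) (Δ : Type) : Option K → Type
  | none => Δ
  | some k => Γ k

/-- Contents of the stacks, with contents `l` of the additional stack. -/
def extStk (l : List Δ) (S : ∀ k, List (Γ k)) : ∀ k, List (ExtStack Γ Δ k)
  | none => l
  | some k => S k

/-- A statement of a machine, read as a statement of a machine with an additional stack, an
additional label, and an additional local variable. -/
def Stmt.ext {τ : Type} : Stmt Γ Λ σ → Stmt (ExtStack Γ Δ) (Option Λ) (τ × σ)
  | .push k f q => .push (some k) (fun v => f v.2) q.ext
  | .peek k f q => .peek (some k) (fun v o => (v.1, f v.2 o)) q.ext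
  | .pop k f q => .pop (some k) (fun v o => (v.1, f v.2 o)) q.ext
  | .load a q => .load (fun v => (v.1, a v.2)) q.ext
  | .branch f q₁ q₂ => .branch (fun v => f v.2) q₁.ext q₂.ext
  | .goto f => .goto fun v => some (f v.2)
  | .halt => .halt

/-- A configuration of a machine, read as a configuration of the extended machine. -/
def Cfg.ext {τ : Type} (t : τ) (l : List Δ) (c : Cfg Γ Λ σ) :
    Cfg (ExtStack Γ Δ) (Option Λ) (τ × σ) :=
  ⟨c.l.map some, (t, c.var), extStk l c.stk⟩

variable [DecidableEq K]

theorem update_some_extStk (l : List Δ) (S : ∀ k, List (Γ k)) (k : K) (a : List (Γ k)) :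
    Function.update (extStk l S) (some k) a = extStk l (Function.update S k a) := by
  funext j
  cases j with
  | none => rfl
  | some j =>
    by_cases h : j = k
    · subst h
      exact (Function.update_self (some j) a (extStk l S)).trans (Function.update_self j a S).symm
    · have h' : (some j : Option K) ≠ some k := by simpa using h
      exact (Function.update_of_ne h' a (extStk l S)).trans (Function.update_of_ne h a S).symm

theorem update_none_extStk (l l' : List Δ) (S : ∀ k, List (Γ k)) :
    Function.update (extStk l S) none l' = extStk l' S := by
  funext j
  cases j <;> rfl

/-- Translated statements never touch the additional stack or variable, so execution commutes with
the embedding of configurations. -/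
theorem stepAux_ext {τ : Type} (t : τ) (l : List Δ) (q : Stmt Γ Λ σ) (v : σ)
    (S : ∀ k, List (Γ k)) :
    stepAux (q.ext (Δ := Δ) (τ := τ)) (t, v) (extStk l S) = (stepAux q v S).ext t l := by
  induction q generalizing v S with
  | push k f q ih =>
    simp only [Stmt.ext, stepAux]
    rw [← ih, ← update_some_extStk]; rfl
  | peek k f q ih =>
    simp only [Stmt.ext, stepAux]
    rw [← ih]; rfl
  | pop k f q ih =>
    simp only [Stmt.ext, stepAux]
    rw [← ih, ← update_some_extStk]; rfl
  | load a q ih => exact ih _ _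
  | branch f q₁ q₂ ih₁ ih₂ =>
    simp only [Stmt.ext, stepAux]
    cases f v
    · exact ih₂ _ _
    · exact ih₁ _ _
  | goto f => rfl
  | halt => rfl

end Turing.TM2

namespace Turing.FinTM2

open TM2

variable (tm : FinTM2) (Γ₁ Γ₂ : Type)

/-- The statement that moves the symbols in `Γ₁` from the additional input stack to the input stack
of the machine `tm`, discards the symbols in `Γ₂`, and starts `tm` when the stack is empty. -/
def filterInputStmt (e : Γ₁ → tm.Γ tm.k₀) [Inhabited Γ₁] :
    TM2.Stmt (ExtStack tm.Γ (Γ₁ ⊕ Γ₂)) (Option tm.Λ) (Option (Γ₁ ⊕ Γ₂) × tm.σ) :=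
  .pop none (fun v o => (o, v.2)) <|
    .branch (fun v => v.1.isSome)
      (.branch (fun v => (v.1.bind Sum.getLeft?).isSome)
        (.push (some tm.k₀) (fun v => e ((v.1.bind Sum.getLeft?).getD default))
          (.goto fun _ => none))
        (.goto fun _ => none))
      (.goto fun _ => some tm.main)

/-- The machine that runs `tm` on the symbols in `Γ₁` of its input, in reverse order. -/
def filterInput (e : Γ₁ → tm.Γ tm.k₀) [Inhabited Γ₁] [Fintype Γ₁] [Fintype Γ₂] : FinTM2 where
  K := Option tm.K
  kDecidableEq := inferInstance
  kFin := letI := tm.kFin; inferInstance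
  k₀ := none
  k₁ := some tm.k₁
  Γ := ExtStack tm.Γ (Γ₁ ⊕ Γ₂)
  Λ := Option tm.Λ
  main := none
  ΛFin := letI := tm.ΛFin; inferInstance
  σ := Option (Γ₁ ⊕ Γ₂) × tm.σ
  initialState := (none, tm.initialState)
  σFin := letI := tm.σFin; inferInstance
  Γk₀Fin := inferInstanceAs (Fintype (Γ₁ ⊕ Γ₂))
  m
    | none => tm.filterInputStmt Γ₁ Γ₂ e
    | some q => (tm.m q).ext

variable {Γ₁ Γ₂} (e : Γ₁ → tm.Γ tm.k₀) [Inhabited Γ₁] [Fintype Γ₁] [Fintype Γ₂]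

/-- Contents of the stacks of `tm` that consist of an input only. -/
def inputStk (s : List (tm.Γ tm.k₀)) : ∀ k, List (tm.Γ k) := (initList tm s).stk

theorem inputStk_self (s : List (tm.Γ tm.k₀)) : tm.inputStk s tm.k₀ = s := by
  simp [inputStk, initList]

theorem update_inputStk (s s' : List (tm.Γ tm.k₀)) :
    Function.update (tm.inputStk s) tm.k₀ s' = tm.inputStk s' := by
  funext k
  by_cases h : k = tm.k₀
  · subst h
    simp [inputStk_self]
  · rw [Function.update_of_ne h]
    simp [inputStk, initList, h]

theorem filterInput_step_ext (c : tm.Cfg) :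
    (tm.filterInput Γ₁ Γ₂ e).step (TM2.Cfg.ext none [] c) =
      (tm.step c).map (TM2.Cfg.ext none []) := by
  obtain ⟨l, v, S⟩ := c
  cases l with
  | none => rfl
  | some l =>
    exact congrArg some (stepAux_ext none [] (tm.m l) v S)

/-- The configuration of the machine `filterInput` while it moves its input. -/
def movingCfg (t : Option (Γ₁ ⊕ Γ₂)) (l : List (Γ₁ ⊕ Γ₂)) (s : List (tm.Γ tm.k₀)) :
    (tm.filterInput Γ₁ Γ₂ e).Cfg :=
  ⟨some none, (t, tm.initialState), extStk l (tm.inputStk s)⟩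

theorem filterInput_step_inl (t : Option (Γ₁ ⊕ Γ₂)) (a : Γ₁) (l : List (Γ₁ ⊕ Γ₂))
    (s : List (tm.Γ tm.k₀)) :
    (tm.filterInput Γ₁ Γ₂ e).step (tm.movingCfg e t (.inl a :: l) s) =
      some (tm.movingCfg e (some (.inl a)) l (e a :: s)) := by
  refine congrArg some ?_
  change stepAux (tm.filterInputStmt Γ₁ Γ₂ e) (_, _) (extStk _ _) = _
  simp only [filterInputStmt, stepAux, update_none_extStk, extStk, List.head?_cons,
    Option.isSome_some, Option.bind_some, Sum.getLeft?_inl, cond_true, Option.getD_some,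
    List.tail_cons]
  rw [inputStk_self]
  erw [update_some_extStk]
  rw [update_inputStk]
  rfl

theorem filterInput_step_inr (t : Option (Γ₁ ⊕ Γ₂)) (a : Γ₂) (l : List (Γ₁ ⊕ Γ₂))
    (s : List (tm.Γ tm.k₀)) :
    (tm.filterInput Γ₁ Γ₂ e).step (tm.movingCfg e t (.inr a :: l) s) =
      some (tm.movingCfg e (some (.inr a)) l s) := by
  refine congrArg some ?_
  change stepAux (tm.filterInputStmt Γ₁ Γ₂ e) (_, _) (extStk _ _) = _
  simp only [filterInputStmt, stepAux, update_none_extStk, extStk, List.head?_cons,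
    Option.isSome_some, Option.bind_some, Sum.getLeft?_inr, cond_true, Option.isSome_none,
    cond_false, List.tail_cons]
  rfl

/-- The pop from the empty stack stores `none`, which resets the additional variable to its initial
value. `haltList` demands this value at the end. -/
theorem filterInput_step_nil (t : Option (Γ₁ ⊕ Γ₂)) (s : List (tm.Γ tm.k₀)) :
    (tm.filterInput Γ₁ Γ₂ e).step (tm.movingCfg e t [] s) =
      some (TM2.Cfg.ext none [] (initList tm s)) := by
  refine congrArg some ?_
  change stepAux (tm.filterInputStmt Γ₁ Γ₂ e) (_, _) (extStk _ _) = _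
  simp only [filterInputStmt, stepAux, update_none_extStk, extStk, List.head?_nil,
    Option.isSome_none, cond_false, List.tail_nil]
  rfl

/-- One step per symbol and one for the final pop from the empty stack. Moving between stacks
reverses the word, whence `reverseAux`. -/
theorem filterInput_move (t : Option (Γ₁ ⊕ Γ₂)) (l : List (Γ₁ ⊕ Γ₂)) (s : List (tm.Γ tm.k₀)) :
    (flip bind (tm.filterInput Γ₁ Γ₂ e).step)^[l.length + 1] (some (tm.movingCfg e t l s)) =
      some (TM2.Cfg.ext none [] (initList tm
        ((l.filterMap Sum.getLeft?).map e |>.reverseAux s))) := by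
  induction l generalizing t s with
  | nil => exact tm.filterInput_step_nil e t s
  | cons a l ih =>
    rw [List.length_cons, Function.iterate_succ_apply]
    cases a with
    | inl a =>
      rw [show flip bind (tm.filterInput Γ₁ Γ₂ e).step (some (tm.movingCfg e t (.inl a :: l) s)) =
        some (tm.movingCfg e (some (.inl a)) l (e a :: s)) from tm.filterInput_step_inl e t a l s]
      rw [ih, List.filterMap_cons]
      rfl
    | inr a =>
      rw [show flip bind (tm.filterInput Γ₁ Γ₂ e).step (some (tm.movingCfg e t (.inr a :: l) s)) =
        some (tm.movingCfg e (some (.inr a)) l s) from tm.filterInput_step_inr e t a l s]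
      rw [ih, List.filterMap_cons]
      rfl

theorem filterInput_iterate_ext (n : ℕ) (c : Option tm.Cfg) :
    (flip bind (tm.filterInput Γ₁ Γ₂ e).step)^[n] (c.map (TM2.Cfg.ext none [])) =
      ((flip bind tm.step)^[n] c).map (TM2.Cfg.ext none []) := by
  induction n generalizing c with
  | zero => rfl
  | succ n ih =>
    rw [Function.iterate_succ_apply, Function.iterate_succ_apply, ← ih]
    congr 1
    cases c with
    | none => rfl
    | some c => exact tm.filterInput_step_ext e c

theorem movingCfg_none_nil (l : List (Γ₁ ⊕ Γ₂)) :
    tm.movingCfg e none l [] = initList (tm.filterInput Γ₁ Γ₂ e) l := by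
  unfold movingCfg initList
  congr 1
  funext k
  cases k with
  | none => rfl
  | some k =>
    change tm.inputStk [] k = _
    rw [dif_neg (by simp [filterInput])]
    simp only [inputStk, initList]
    split_ifs with h
    · subst h; rfl
    · rfl

theorem haltList_stk_self (s : List (tm.Γ tm.k₁)) : (haltList tm s).stk tm.k₁ = s := by
  simp [haltList]

theorem haltList_stk_of_ne (s : List (tm.Γ tm.k₁)) {k : tm.K} (h : k ≠ tm.k₁) :
    (haltList tm s).stk k = [] := by
  simp [haltList, h]

theorem ext_haltList (s : List (tm.Γ tm.k₁)) :
    TM2.Cfg.ext none [] (haltList tm s) =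
      haltList (tm.filterInput Γ₁ Γ₂ e) s := by
  unfold TM2.Cfg.ext haltList
  refine congrArg (TM2.Cfg.mk none (none, tm.initialState)) ?_
  funext k
  cases k with
  | none => rfl
  | some k =>
    by_cases h : k = tm.k₁
    · subst h
      exact (tm.haltList_stk_self s).trans
        ((tm.filterInput Γ₁ Γ₂ e).haltList_stk_self s).symm
    · have h' : (some k : Option tm.K) ≠ some tm.k₁ := by simpa using h
      exact (tm.haltList_stk_of_ne s h).trans
        ((tm.filterInput Γ₁ Γ₂ e).haltList_stk_of_ne s h').symm

theorem filterInput_outputsInTime {s : List (tm.Γ tm.k₀)} {s' : List (tm.Γ tm.k₁)} {m : ℕ}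
    (h : TM2OutputsInTime tm s (some s') m) {l : List (Γ₁ ⊕ Γ₂)}
    (hl : ((l.filterMap Sum.getLeft?).map e).reverse = s) :
    Nonempty (TM2OutputsInTime (tm.filterInput Γ₁ Γ₂ e) l (some s') (m + (l.length + 1))) := by
  obtain ⟨⟨n, hn⟩, hm⟩ := h
  refine ⟨⟨⟨n + (l.length + 1), ?_⟩, Nat.add_le_add_right hm _⟩⟩
  rw [Function.iterate_add_apply, ← movingCfg_none_nil]
  refine (congrArg _ (filterInput_move tm e none l [])).trans ?_
  rw [List.reverseAux_eq, List.append_nil, hl]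
  refine (tm.filterInput_iterate_ext e n (some _)).trans ?_
  refine (congrArg _ hn).trans ?_
  exact congrArg some (tm.ext_haltList e s')

end Turing.FinTM2

theorem Polynomial.eval_nat_mono (q : Polynomial ℕ) : Monotone fun n => q.eval n := by
  intro a b h
  simp only [Polynomial.eval_eq_sum, Polynomial.sum]
  gcongr

open Computability in
/-- A function that is computable in polynomial time remains so if its argument comes with
additional data, provided that its encoding is symmetric. -/
theorem Turing.TM2ComputableInPolyTime.comp_fst {α β δ Γ₁ Γ₂ Γ₃ : Type} [Inhabited Γ₁]
    [Fintype Γ₁] [Fintype Γ₂] (ea : Encoding α Γ₁) (eb : Encoding β Γ₂) (ed : δ → List Γ₃)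
    (hea : ∀ a, (ea.encode a).reverse = ea.encode a) {f : α → δ}
    (h : TM2ComputableInPolyTime ea.encode ed f) :
    Nonempty (TM2ComputableInPolyTime (encodingProd ea eb).encode ed fun x => f x.1) := by
  refine ⟨⟨⟨h.tm.filterInput Γ₁ Γ₂ h.inputAlphabet.symm, Equiv.refl _, h.outputAlphabet⟩,
    h.time + (.X + 1), fun x => ?_⟩⟩
  have hl : ((((encodingProd ea eb).encode x).filterMap Sum.getLeft?).map
      h.inputAlphabet.symm).reverse = (ea.encode x.1).map h.inputAlphabet.symm := by
    rw [← List.map_reverse]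
    simp [encodingProd, List.filterMap_append, List.filterMap_map, Function.comp_def, hea]
  have ho := (h.tm.filterInput_outputsInTime _ (h.outputsFun x.1) hl).some
  have hid : ((encodingProd ea eb).encode x).map (Equiv.refl (Γ₁ ⊕ Γ₂)).invFun =
    (encodingProd ea eb).encode x := List.map_id _
  rw [← hid] at ho
  refine ⟨ho.toEvalsTo, ho.steps_le_m.trans ?_⟩
  have h2 : (ea.encode x.1).length ≤ ((encodingProd ea eb).encode x).length := by
    simp [encodingProd]
  have h3 := h.time.eval_nat_mono h2
  simp only [Polynomial.eval_add, Polynomial.eval_X, Polynomial.eval_one, List.length_map] at *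
  lia

open Computability in
-- Unary words are palindromes, so the reversal caused by the move is harmless.
theorem Computability.reverse_unaryEncodeNat (n : ℕ) :
    (unaryEncodeNat n).reverse = unaryEncodeNat n := by
  have h : ∀ n, unaryEncodeNat n = List.replicate n true := by
    intro n
    induction n with
    | zero => rfl
    | succ n ih => rw [unaryEncodeNat, ih, List.replicate_succ]
  rw [h, List.reverse_replicate]

open Computability in
theorem PolyTimeUniform.comp_fst {C : ℕ → QCircuit} (h : PolyTimeUniform unaryEncodingNat C) :
    PolyTimeUniform (encodingProd unaryEncodingNat unaryEncodingNat) fun x : ℕ × ℕ => C x.1 :=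
  h.elim fun h => h.comp_fst _ _ _ reverse_unaryEncodeNat

/-! ### Composition of Boolean circuits -/

/-- Renaming of the wires to which a gate refers. -/
def BoolGate.rename (ρ : ℕ → ℕ) : BoolGate → BoolGate
  | .const b => .const b
  | .not i => .not (ρ i)
  | .and i j => .and (ρ i) (ρ j)
  | .or i j => .or (ρ i) (ρ j)

theorem BoolGate.eval_rename {ρ : ℕ → ℕ} {u v : List Bool}
    (h : ∀ j, v.getD (ρ j) false = u.getD j false) (g : BoolGate) :
    (g.rename ρ).eval v = g.eval u := by
  cases g <;> simp only [BoolGate.rename, BoolGate.eval, h]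

namespace BoolCircuit

/-- The values of all wires after the gates `gs`, starting from the values `v`. -/
def run (gs : List BoolGate) (v : List Bool) : List Bool :=
  gs.foldl (fun v g => v ++ [g.eval v]) v

theorem run_append (gs gs' : List BoolGate) (v : List Bool) :
    run (gs ++ gs') v = run gs' (run gs v) :=
  List.foldl_append

theorem length_run (gs : List BoolGate) (v : List Bool) :
    (run gs v).length = v.length + gs.length := by
  induction gs generalizing v with
  | nil => rfl
  | cons g gs ih =>
    change (run gs (v ++ [g.eval v])).length = _
    rw [ih]
    simp only [List.length_append, List.length_cons, List.length_nil]
    lia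

theorem getD_run (gs : List BoolGate) (v : List Bool) {i : ℕ} (hi : i < v.length) :
    (run gs v).getD i false = v.getD i false := by
  induction gs generalizing v with
  | nil => rfl
  | cons g gs ih =>
    change (run gs (v ++ [g.eval v])).getD i false = _
    rw [ih _ (by simp; lia), List.getD_append _ _ _ _ hi]

/-- The position of a wire of a circuit with `N` inputs when the circuit is appended to a circuit
with `ℓ` wires, and its inputs are identified with wires by `σ`. -/
def shift (N ℓ : ℕ) (σ : ℕ → ℕ) (j : ℕ) : ℕ := if j < N then σ j else ℓ + (j - N)

/-- Induction on the gates: `hv` keeps the offset between the two wire lists fixed, so each new wire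
of `u` is matched with the new wire of `v`. In `h` the index is unrestricted, because gates may name
missing wires, which must read `false` on both sides. -/
theorem getD_run_shift {N ℓ : ℕ} {σ : ℕ → ℕ} (hσ : ∀ j < N, σ j < ℓ) (gs : List BoolGate)
    {u v : List Bool} (hu : N ≤ u.length) (hv : v.length + N = u.length + ℓ)
    (h : ∀ j, v.getD (shift N ℓ σ j) false = u.getD j false) (j : ℕ) :
    (run (gs.map (BoolGate.rename (shift N ℓ σ))) v).getD (shift N ℓ σ j) false =
      (run gs u).getD j false := by
  induction gs generalizing u v with
  | nil => exact h j
  | cons g gs ih =>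
    change (run (gs.map (BoolGate.rename (shift N ℓ σ)))
      (v ++ [(g.rename (shift N ℓ σ)).eval v])).getD (shift N ℓ σ j) false =
      (run gs (u ++ [g.eval u])).getD j false
    rw [BoolGate.eval_rename h]
    refine ih (by simp; lia) (by simp; lia) fun i => ?_
    rcases lt_or_ge i u.length with hi | hi
    · have hs : shift N ℓ σ i < v.length := by
        unfold shift
        split_ifs with hN
        · exact (hσ i hN).trans_le (by lia)
        · lia
      rw [List.getD_append _ _ _ _ hi, List.getD_append _ _ _ _ hs, h]
    · have hs : shift N ℓ σ i = v.length + (i - u.length) := by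
        unfold shift
        rw [if_neg (by lia)]
        lia
      rw [List.getD_append_right _ _ _ _ hi, List.getD_append_right _ _ _ _ (by lia), hs]
      congr 1
      lia

/-- The function `F` on bit strings of length `n` is computed by a circuit of size at most `s`, all
of whose outputs are existing wires. -/
def Computes (n s : ℕ) (F : List Bool → List Bool) : Prop :=
  ∃ C : BoolCircuit, C.size ≤ s ∧ (∀ i ∈ C.outputs, i < n + C.gates.length) ∧
    ∀ x : List Bool, x.length = n → C.eval x = F x

namespace Computes

variable {n m s t k : ℕ} {F G : List Bool → List Bool}

theorem mono (h : Computes n s F) (hst : s ≤ t) : Computes n t F := by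
  obtain ⟨C, hC, h⟩ := h
  exact ⟨C, hC.trans hst, h⟩

theorem congr (h : Computes n s F) (hFG : ∀ x, x.length = n → F x = G x) : Computes n s G := by
  obtain ⟨C, hC, ho, h⟩ := h
  exact ⟨C, hC, ho, fun x hx => (h x hx).trans (hFG x hx)⟩

/-- An output that names a missing wire reads `false`, but might read something else once further
gates are appended. It is redirected to an extra constant wire at position `n + C.gates.length`. -/
theorem of_circuit (C : BoolCircuit) (n : ℕ) : Computes n (C.size + 1) C.eval := by
  refine ⟨⟨C.gates ++ [.const false],
    C.outputs.map fun i => min i (n + C.gates.length)⟩, ?_, ?_, fun x hx => ?_⟩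
  · simp only [size, List.length_append, List.length_map, List.length_cons, List.length_nil]
    lia
  · simp only [List.mem_map, List.length_append, List.length_cons, List.length_nil]
    rintro _ ⟨i, -, rfl⟩
    lia
  · change List.map _ (List.map _ _) = List.map _ _
    rw [List.map_map]
    refine List.map_congr_left fun i _ => ?_
    change (run (C.gates ++ [.const false]) x).getD _ false = (run C.gates x).getD i false
    have hl := length_run C.gates x
    rw [hx] at hl
    rw [run_append]
    change (run C.gates x ++ [false]).getD (min i (n + C.gates.length)) false = _
    rcases lt_or_ge i (n + C.gates.length) with hi | hi
    · rw [min_eq_left hi.le, List.getD_append _ _ _ _ (by lia)]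
    · rw [min_eq_right hi, List.getD_eq_default (run C.gates x) _ (by lia),
        List.getD_append_right _ _ _ _ (by lia), hl]
      simp

theorem append (hF : Computes n s F) (hG : Computes n t G) :
    Computes n (s + t) fun x => F x ++ G x := by
  obtain ⟨C, hC, hCo, hCe⟩ := hF
  obtain ⟨D, hD, hDo, hDe⟩ := hG
  refine ⟨⟨C.gates ++ D.gates.map (BoolGate.rename (shift n (n + C.gates.length) id)),
    C.outputs ++ D.outputs.map (shift n (n + C.gates.length) id)⟩, ?_, ?_, fun x hx => ?_⟩
  · simp only [size, List.length_append, List.length_map] at *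
    lia
  · simp only [List.mem_append, List.mem_map, List.length_append, List.length_map]
    rintro _ (h | ⟨i, hi, rfl⟩)
    · have := hCo _ h
      lia
    · have := hDo _ hi
      simp only [shift, id]
      split_ifs <;> lia
  · change _ = F x ++ G x
    rw [← hCe x hx, ← hDe x hx]
    have hl := length_run C.gates x
    rw [hx] at hl
    change List.map (fun i => (run _ x).getD i false) _ = List.map (fun i => (run _ x).getD i false) _
      ++ List.map (fun i => (run _ x).getD i false) _
    rw [List.map_append, List.map_map, run_append]
    congr 1
    · refine List.map_congr_left fun i hi => getD_run _ _ ?_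
      rw [hl]
      exact hCo i hi
    · refine List.map_congr_left fun i hi => getD_run_shift (fun j hj => ?_) _ hx.ge ?_ ?_ _
      · simp only [id]; lia
      · lia
      · intro j
        unfold shift
        split_ifs with hj
        · exact getD_run _ _ (by simpa [hx] using hj)
        · rw [List.getD_eq_default _ _ (by lia), List.getD_eq_default _ _ (by lia)]

/-- The gates of the second circuit are appended, with its inputs identified with the output wires
of the first. -/
theorem comp (hG : Computes m t G) (hF : Computes n s F)
    (hm : ∀ x, x.length = n → (F x).length = m) : Computes n (s + t) fun x => G (F x) := by
  obtain ⟨C, hC, hCo, hCe⟩ := hF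
  obtain ⟨D, hD, hDo, hDe⟩ := hG
  have hCm : C.outputs.length = m := by
    have h := hm (List.replicate n false) (by simp)
    rw [← hCe _ (by simp)] at h
    simpa [eval] using h
  have hσ : ∀ j < m, C.outputs.getD j 0 < n + C.gates.length := fun j hj => by
    rw [List.getD_eq_getElem _ _ (by lia)]
    exact hCo _ (List.getElem_mem _)
  set σ : ℕ → ℕ := fun j => C.outputs.getD j 0
  refine ⟨⟨C.gates ++ D.gates.map (BoolGate.rename (shift m (n + C.gates.length) σ)),
    D.outputs.map (shift m (n + C.gates.length) σ)⟩, ?_, ?_, fun x hx => ?_⟩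
  · simp only [size, List.length_append, List.length_map] at *
    lia
  · simp only [List.mem_map, List.length_append, List.length_map]
    rintro _ ⟨i, hi, rfl⟩
    have := hDo _ hi
    unfold shift
    split_ifs with him
    · have := hσ i him
      lia
    · lia
  · have hFx := hm x hx
    change _ = G (F x)
    rw [← hDe _ hFx]
    have hl := length_run C.gates x
    rw [hx] at hl
    change List.map (fun i => (run _ x).getD i false) _ =
      List.map (fun i => (run _ _).getD i false) _
    rw [List.map_map, run_append]
    refine List.map_congr_left fun i hi => getD_run_shift hσ _ hFx.ge ?_ ?_ _
    · lia
    · intro j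
      unfold shift
      split_ifs with hj
      · rw [← hCe x hx]
        change _ = (List.map (fun i => (run C.gates x).getD i false) C.outputs).getD j false
        rw [List.getD_eq_getElem (List.map _ _) _ (by simp; lia), List.getElem_map]
        change (run C.gates x).getD (C.outputs.getD j 0) false = _
        rw [List.getD_eq_getElem C.outputs _ (by lia)]
      · rw [List.getD_eq_default _ _ (by lia), List.getD_eq_default _ _ (by lia)]

theorem getD {i : ℕ} (hi : i < n) : Computes n 1 fun x => [x.getD i false] :=
  ⟨⟨[], [i]⟩, le_rfl, by simpa using hi, fun _ _ => rfl⟩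

theorem const (n : ℕ) (b : Bool) : Computes n 2 fun _ => [b] := by
  refine ⟨⟨[.const b], [n]⟩, le_rfl, by simp, fun x hx => ?_⟩
  change [(x ++ [b]).getD n false] = [b]
  rw [List.getD_append_right _ _ _ _ hx.le, hx]
  simp

variable {f g : List Bool → Bool}

theorem not (hf : Computes n s fun x => [f x]) : Computes n (s + 2) fun x => [!f x] := by
  have h : Computes 1 2 fun y => [!y.getD 0 false] := by
    refine ⟨⟨[.not 0], [1]⟩, le_rfl, by simp, fun x hx => ?_⟩
    obtain ⟨a, rfl⟩ := List.length_eq_one_iff.1 hx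
    rfl
  exact (h.comp hf fun _ _ => rfl).congr fun _ _ => rfl

theorem and (hf : Computes n s fun x => [f x]) (hg : Computes n t fun x => [g x]) :
    Computes n (s + t + 2) fun x => [f x && g x] := by
  have h : Computes 2 2 fun y => [y.getD 0 false && y.getD 1 false] := by
    refine ⟨⟨[.and 0 1], [2]⟩, le_rfl, by simp, fun x hx => ?_⟩
    obtain ⟨a, b, rfl⟩ := List.length_eq_two.1 hx
    rfl
  exact (h.comp (hf.append hg) fun _ _ => rfl).congr fun _ _ => rfl

theorem or (hf : Computes n s fun x => [f x]) (hg : Computes n t fun x => [g x]) :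
    Computes n (s + t + 2) fun x => [f x || g x] := by
  have h : Computes 2 2 fun y => [y.getD 0 false || y.getD 1 false] := by
    refine ⟨⟨[.or 0 1], [2]⟩, le_rfl, by simp, fun x hx => ?_⟩
    obtain ⟨a, b, rfl⟩ := List.length_eq_two.1 hx
    rfl
  exact (h.comp (hf.append hg) fun _ _ => rfl).congr fun _ _ => rfl

theorem flatMap {α : Type*} (l : List α) {H : α → List Bool → List Bool}
    (h : ∀ a ∈ l, Computes n s (H a)) :
    Computes n (l.length * s) fun x => l.flatMap fun a => H a x := by
  induction l with
  | nil => exact ⟨⟨[], []⟩, by simp [size], by simp, fun _ _ => rfl⟩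
  | cons a l ih =>
    refine ((h a (by simp)).append (ih fun b hb => h b (by simp [hb]))).mono ?_
    rw [List.length_cons]
    lia

theorem map {α : Type*} (l : List α) {H : α → List Bool → Bool}
    (h : ∀ a ∈ l, Computes n s fun x => [H a x]) :
    Computes n (l.length * s) fun x => l.map fun a => H a x :=
  (flatMap l h).congr fun _ _ => List.map_eq_flatMap.symm

theorem const_list (n : ℕ) (l : List Bool) : Computes n (l.length * 2) fun _ => l :=
  (map l fun b _ => const n b).congr fun _ _ => List.map_id l

/-- The first bits of the unary representation of the number of true bits. -/
theorem count_unary {l : List (List Bool → Bool)} (h : ∀ f ∈ l, Computes n s fun x => [f x])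
    (t : ℕ) : Computes n (l.length * (s + (t + 1) * 7) + (t + 1) * 2) fun x =>
      (List.range (t + 1)).map fun j => decide (j ≤ l.countP fun f => f x) := by
  induction l with
  | nil =>
    refine (const_list n ((List.range (t + 1)).map fun j => decide (j ≤ 0))).mono ?_
    simp
  | cons f l ih =>
    -- Adding `f` to the list: the count reaches `j` if it did before, or if `f x` holds and it had
    -- reached `j - 1`. In `y`, entry `0` is `f x` and entry `j + 1` is the old bit `j`. For `j = 0`
    -- the entry `y 0` is read twice, harmlessly, since the first disjunct is already true.
    have hstep : Computes (t + 2) ((List.range (t + 1)).length * 7) fun y =>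
        (List.range (t + 1)).map fun j =>
          (y.getD (j + 1) false || (y.getD 0 false && y.getD j false)) := by
      refine map _ fun j hj => ?_
      rw [List.mem_range] at hj
      exact (getD (by lia)).or ((getD (by lia)).and (getD (by lia)))
    have ih' := (h f (by simp)).append (ih fun g hg => h g (by simp [hg]))
    refine ((hstep.comp ih' fun x _ => by simp).mono ?_).congr fun x _ => ?_
    · simp only [List.length_range, List.length_cons]
      lia
    · refine List.map_congr_left fun j hj => ?_
      rw [List.mem_range] at hj
      have hget : ∀ i < t + 1, ((List.range (t + 1)).map fun j =>
          decide (j ≤ l.countP fun f => f x)).getD i false =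
          decide (i ≤ l.countP fun f => f x) := fun i hi => by
        rw [List.getD_eq_getElem _ _ (by simpa using hi)]
        simp
      simp only [List.cons_append, List.nil_append, List.getD_cons_succ, List.getD_cons_zero]
      rw [hget j hj, List.countP_cons]
      rcases j with _ | j
      · simp
      · rw [List.getD_cons_succ, hget j (by lia)]
        cases hfx : f x
        · simp
        · simp only [Bool.true_and, if_true]
          rw [← Bool.decide_or]
          congr 1
          simp only [eq_iff_iff]
          lia

/-- Threshold functions. -/
theorem threshold {l : List (List Bool → Bool)} (h : ∀ f ∈ l, Computes n s fun x => [f x])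
    (t : ℕ) : Computes n (l.length * (s + (t + 1) * 7) + (t + 1) * 2 + 1) fun x =>
      [decide (t ≤ l.countP fun f => f x)] := by
  refine ((getD (Nat.lt_succ_self t)).comp (count_unary h t) fun x _ => by simp).congr
    fun x _ => ?_
  rw [List.getD_eq_getElem _ _ (by simp)]
  simp

end Computes

end BoolCircuit

/-! ### Derandomisation by a majority vote -/

/-- Finitely many experiments that fail with probability at most `1/3` can be derandomised: some
list of random choices keeps the exponential moment of the numbers of failures below its mean. -/
theorem exists_list_sum_two_pow_countP_le {W Ω : Type*} [Fintype W] [Fintype Ω] [Nonempty Ω]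
    (bad : W → Ω → Bool)
    (h : ∀ w, 3 * (Finset.univ.filter fun ω => bad w ω = true).card ≤ Fintype.card Ω) (T : ℕ) :
    ∃ l : List Ω, l.length = T ∧
      ∑ w, (2 : ℝ) ^ l.countP (bad w) ≤ Fintype.card W * (4 / 3 : ℝ) ^ T := by
  classical
  induction T with
  | zero => exact ⟨[], rfl, by simp⟩
  | succ T ih =>
    obtain ⟨l, hl, hs⟩ := ih
    -- A failure doubles the weight of `w`, so the mean factor is at most `2 · 1/3 + 1 · 2/3 = 4/3`.
    have hb : ∀ w, ∑ ω, (if bad w ω = true then (2 : ℝ) else 1) ≤ 4 / 3 * Fintype.card Ω := by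
      intro w
      have h1 : ∀ ω, (if bad w ω = true then (2 : ℝ) else 1) =
          (if bad w ω = true then 1 else 0) + 1 := fun ω => by
        split_ifs <;> norm_num
      have h2 : (3 : ℝ) * (Finset.univ.filter fun ω => bad w ω = true).card ≤ Fintype.card Ω := by
        exact_mod_cast h w
      simp only [h1, Finset.sum_add_distrib, Finset.sum_boole, Finset.sum_const, Finset.card_univ,
        nsmul_eq_mul, mul_one]
      linarith
    -- Some choice does no worse than the average.
    obtain ⟨ω, -, hω⟩ : ∃ ω ∈ (Finset.univ : Finset Ω),
        ∑ w, (2 : ℝ) ^ l.countP (bad w) * (if bad w ω = true then 2 else 1) ≤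
          4 / 3 * ∑ w, (2 : ℝ) ^ l.countP (bad w) := by
      refine Finset.exists_le_of_sum_le Finset.univ_nonempty ?_
      rw [Finset.sum_comm, Finset.sum_const, nsmul_eq_mul, Finset.card_univ, Finset.mul_sum,
        Finset.mul_sum]
      refine Finset.sum_le_sum fun w _ => ?_
      rw [← Finset.mul_sum]
      have := mul_le_mul_of_nonneg_left (hb w)
        (by positivity : (0 : ℝ) ≤ 2 ^ l.countP (bad w))
      linarith
    refine ⟨ω :: l, by simp [hl], ?_⟩
    have he : ∀ w, (2 : ℝ) ^ (ω :: l).countP (bad w) =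
        2 ^ l.countP (bad w) * (if bad w ω = true then 2 else 1) := fun w => by
      rw [List.countP_cons]
      split_ifs <;> simp [pow_succ]
    simp only [he]
    rw [pow_succ]
    linarith

/-- Since `(4/3)^12 < 2^5`, the moment after `12 (d + 1)` trials is at most `2^d · 2^(5 (d + 1)) <
2^(6 (d + 1))`. Each word contributes one summand, so it fails in fewer than half of the trials. -/
theorem exists_list_countP_lt {W Ω : Type*} [Fintype W] [Fintype Ω] [Nonempty Ω] {d : ℕ}
    (hW : Fintype.card W = 2 ^ d) (bad : W → Ω → Bool)
    (h : ∀ w, 3 * (Finset.univ.filter fun ω => bad w ω = true).card ≤ Fintype.card Ω) :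
    ∃ l : List Ω, l.length = 12 * (d + 1) ∧ ∀ w, l.countP (bad w) < 6 * (d + 1) := by
  obtain ⟨l, hl, hs⟩ := exists_list_sum_two_pow_countP_le bad h (12 * (d + 1))
  refine ⟨l, hl, fun w => ?_⟩
  have h1 : (2 : ℝ) ^ l.countP (bad w) ≤ Fintype.card W * (4 / 3 : ℝ) ^ (12 * (d + 1)) :=
    (Finset.single_le_sum (f := fun w => (2 : ℝ) ^ l.countP (bad w))
      (fun _ _ => by positivity) (Finset.mem_univ w)).trans hs
  have h2 : ((4 / 3 : ℝ) ^ 12) ^ (d + 1) ≤ (2 ^ 5) ^ (d + 1) := by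
    gcongr
    norm_num
  rw [hW, pow_mul] at h1
  push_cast at h1
  have h3 : (2 : ℝ) ^ l.countP (bad w) < 2 ^ (6 * (d + 1)) :=
    calc (2 : ℝ) ^ l.countP (bad w) ≤ 2 ^ d * (2 ^ 5) ^ (d + 1) :=
          h1.trans (mul_le_mul_of_nonneg_left h2 (by positivity))
      _ = 2 ^ (d + 5 * (d + 1)) := by rw [← pow_mul, ← pow_add]
      _ < 2 ^ (6 * (d + 1)) := pow_lt_pow_right₀ (by norm_num) (by lia)
  exact (pow_lt_pow_iff_right₀ (by norm_num)).1 h3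

/-- If a majority of at least half of the votes is guaranteed to be correct, then it is found by
counting. -/
theorem decide_le_countP_eq {Ω : Type*} {l : List Ω} {t : ℕ} (hl : l.length = 2 * t)
    {vote : Ω → Bool} {b : Bool} (h : l.countP (fun ω => vote ω != b) < t) :
    decide (t ≤ l.countP vote) = b := by
  cases b
  · simp only [Bool.bne_false] at h
    simpa using h
  · have h1 := List.length_eq_countP_add_countP vote (l := l)
    have h2 : l.countP (fun ω => vote ω != true) = l.countP (fun a => ¬ vote a = true) :=
      List.countP_congr fun ω _ => by simp
    rw [h2] at h
    simp only [decide_eq_true_eq]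
    lia

/-! ### Bit strings encoded in points of the cube -/

/-- The points of the cube whose coordinates have first and second binary digits `00` or `10`
(up to end points). -/
def codeDomain (d : ℕ) : Set (EuclideanSpace ℝ (Fin d)) :=
  {x | ∀ i, x i ∈ Set.Icc (0 : ℝ) (1 / 4) ∪ Set.Icc (1 / 2) (3 / 4)}

/-- The bits encoded in a point. -/
noncomputable def codeWord {d : ℕ} (x : EuclideanSpace ℝ (Fin d)) (i : Fin d) : Bool :=
  decide (1 / 2 ≤ x i)

/-- The points of the cube whose first `p + 2` binary digits encode the bits `w`, followed by
zeros. -/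
def codeCell {d : ℕ} (p : ℕ) (w : Fin d → Bool) : Set (EuclideanSpace ℝ (Fin d)) :=
  {x | ∀ i, x i ∈ Set.Ioo (if w i then 1 / 2 else 0 : ℝ)
    ((if w i then 1 / 2 else 0) + (1 / 2) ^ (p + 2))}

theorem half_pow_le (p : ℕ) : (1 / 2 : ℝ) ^ (p + 2) ≤ 1 / 4 := by
  calc (1 / 2 : ℝ) ^ (p + 2) ≤ (1 / 2) ^ 2 :=
        pow_le_pow_of_le_one (by norm_num) (by norm_num) (by lia)
    _ = 1 / 4 := by norm_num

/-- The exponent `p + 2` keeps the side at most `1/4`, even for `p = 0`. -/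
theorem codeCell_subset {d : ℕ} (p : ℕ) (w : Fin d → Bool) : codeCell p w ⊆ codeDomain d := by
  intro x hx i
  have hp := half_pow_le p
  have := hx i
  split_ifs at this with h
  · exact Or.inr ⟨this.1.le, by linarith [this.2]⟩
  · exact Or.inl ⟨this.1.le, by linarith [this.2]⟩

theorem codeWord_eq {d p : ℕ} {w : Fin d → Bool} {x : EuclideanSpace ℝ (Fin d)}
    (hx : x ∈ codeCell p w) : codeWord x = w := by
  funext i
  have hp := half_pow_le p
  have := hx i
  unfold codeWord
  cases hw : w i
  · simp only [hw, Bool.false_eq_true, if_false] at this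
    have : ¬ 1 / 2 ≤ x i := by linarith [this.2]
    exact decide_eq_false this
  · simp only [hw, if_true] at this
    simpa using this.1.le

theorem isOpen_codeCell {d : ℕ} (p : ℕ) (w : Fin d → Bool) : IsOpen (codeCell p w) := by
  simp only [codeCell, Set.ofPred_forall]
  exact isOpen_iInter_of_finite fun i => isOpen_Ioo.preimage (by fun_prop)

theorem codeCell_nonempty {d : ℕ} (p : ℕ) (w : Fin d → Bool) : (codeCell p w).Nonempty := by
  -- The centre of the cell.
  refine ⟨WithLp.toLp 2 fun i => (if w i then 1 / 2 else 0) + (1 / 2) ^ (p + 3), fun i => ?_⟩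
  have h : (1 / 2 : ℝ) ^ (p + 3) = (1 / 2) ^ (p + 2) / 2 := by rw [pow_succ]; ring
  have h' : (0 : ℝ) < (1 / 2) ^ (p + 2) := by positivity
  change _ + _ ∈ Set.Ioo _ _
  rw [h]
  constructor <;> linarith

theorem interior_codeDomain_nonempty (d : ℕ) : (interior (codeDomain d)).Nonempty :=
  (codeCell_nonempty 0 fun _ => false).mono
    (interior_maximal (codeCell_subset _ _) (isOpen_codeCell _ _))

theorem isCompact_codeDomain (d : ℕ) : IsCompact (codeDomain d) := by
  have h : IsCompact (Set.univ.pi fun _ : Fin d =>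
      Set.Icc (0 : ℝ) (1 / 4) ∪ Set.Icc (1 / 2) (3 / 4)) :=
    isCompact_univ_pi fun _ => isCompact_Icc.union isCompact_Icc
  refine (h.image (PiLp.continuous_toLp 2 fun _ : Fin d => ℝ)).of_isClosed_subset ?_ ?_
  · simp only [codeDomain, Set.ofPred_forall]
    exact isClosed_iInter fun i => (isClosed_Icc.union isClosed_Icc).preimage (by fun_prop)
  · exact fun x hx => ⟨fun i => x i, fun i _ => hx i, rfl⟩

theorem codeDomain_subset (d : ℕ) : codeDomain d ⊆ unitCube d := by
  intro x hx i
  rcases hx i with h | h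
  · exact ⟨h.1, by linarith [h.2]⟩
  · exact ⟨by linarith [h.1], by linarith [h.2]⟩

/-- The gap between `1/4` and `1/2` makes the threshold at `1/2` locally constant on the domain. -/
theorem continuousOn_codeWord (d : ℕ) :
    ContinuousOn (codeWord : EuclideanSpace ℝ (Fin d) → Fin d → Bool) (codeDomain d) := by
  refine continuousOn_pi.2 fun i => ?_
  have h : ContinuousOn (fun t : ℝ => decide (1 / 2 ≤ t))
      (Set.Icc (0 : ℝ) (1 / 4) ∪ Set.Icc (1 / 2) (3 / 4)) := by
    intro t ht
    refine (continuousWithinAt_const (b := decide (1 / 2 ≤ t))).congr_of_eventuallyEq ?_ rfl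
    rcases ht with h | h
    · filter_upwards [mem_nhdsWithin_of_mem_nhds (Iio_mem_nhds (by linarith [h.2] : t < 1 / 2))]
        with s hs
      have hs' : s < 1 / 2 := hs
      simp only [decide_eq_decide]
      constructor <;> intro <;> linarith [h.2]
    · filter_upwards [self_mem_nhdsWithin,
        mem_nhdsWithin_of_mem_nhds (Ioi_mem_nhds (by linarith [h.1] : (1 / 4 : ℝ) < t))]
        with s hs hs'
      have hs' : 1 / 4 < s := hs'
      have hs2 : 1 / 2 ≤ s := by
        rcases hs with hs | hs
        · linarith [hs.2]
        · exact hs.1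
      simp only [decide_eq_decide]
      exact ⟨fun _ => h.1, fun _ => hs2⟩
  exact h.comp (f := fun x : EuclideanSpace ℝ (Fin d) => x i) (by fun_prop) fun x hx => hx i

theorem binaryDigits_one {d : ℕ} {x : EuclideanSpace ℝ (Fin d)} (hx : x ∈ codeDomain d) :
    binaryDigits 1 x = List.ofFn (codeWord x) := by
  simp only [binaryDigits, List.range_one, List.flatMap_cons, List.flatMap_nil, List.append_nil]
  congr 1
  funext i
  unfold codeWord
  rcases hx i with h | h
  · have h1 : ⌊2 ^ 1 * x i⌋₊ = 0 := Nat.floor_eq_zero.2 (by linarith [h.2])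
    have h2 : ¬ 1 / 2 ≤ x i := by linarith [h.2]
    rw [h1, decide_eq_false h2]
    simp
  · have h1 : ⌊2 ^ 1 * x i⌋₊ = 1 :=
      (Nat.floor_eq_iff (by linarith [h.1])).2
        ⟨by push_cast; linarith [h.1], by push_cast; linarith [h.2]⟩
    rw [h1]
    simpa using h.1

/-- The digits of the points of a cell. -/
def codeDigits (d p : ℕ) (x : List Bool) : List Bool :=
  (List.range p).flatMap fun j => (List.finRange d).map fun i : Fin d => x.getD i false && decide (j = 0)

theorem length_codeDigits (d p : ℕ) (x : List Bool) : (codeDigits d p x).length = p * d := by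
  simp [codeDigits, List.length_flatMap]

/-- A circuit that reads `p` digits cannot distinguish the points of a cell. With `p = k + 1`, the
scaled coordinate lies within `1/4` above `0` or `2^k`, and the only set bit of `2^k` is the leading
digit, `j = 0`. -/
theorem binaryDigits_of_mem_codeCell {d p : ℕ} {w : Fin d → Bool} {x : EuclideanSpace ℝ (Fin d)}
    (hx : x ∈ codeCell p w) : binaryDigits p x = codeDigits d p (List.ofFn w) := by
  unfold binaryDigits codeDigits
  refine List.flatMap_congr fun j hj => ?_
  rw [List.mem_range] at hj
  rw [List.ofFn_eq_map]
  refine List.map_congr_left fun i _ => ?_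
  obtain ⟨k, rfl⟩ : ∃ k, p = k + 1 := ⟨p - 1, by lia⟩
  have hk : (0 : ℝ) < 2 ^ k := by positivity
  have hk2 : (2 : ℝ) ^ (k + 1) * (1 / 2) ^ (k + 1 + 2) = 1 / 4 := by
    rw [pow_add (1 / 2 : ℝ) (k + 1) 2, ← mul_assoc, ← mul_pow]
    norm_num
  have hget : (List.ofFn w).getD i false = w i := by
    rw [List.getD_eq_getElem _ _ (by simp)]
    simp
  rw [hget]
  have := hx i
  cases hw : w i
  · simp only [hw, Bool.false_eq_true, if_false, zero_add] at this
    have h1 : ⌊2 ^ (k + 1) * x i⌋₊ = 0 := Nat.floor_eq_zero.2 <| by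
      have := mul_lt_mul_of_pos_left this.2 (by positivity : (0 : ℝ) < 2 ^ (k + 1))
      linarith
    rw [h1]
    simp
  · simp only [hw, if_true] at this
    have h1 : ⌊2 ^ (k + 1) * x i⌋₊ = 2 ^ k := by
      have h2 := mul_lt_mul_of_pos_left this.2 (by positivity : (0 : ℝ) < 2 ^ (k + 1))
      have h3 := mul_lt_mul_of_pos_left this.1 (by positivity : (0 : ℝ) < 2 ^ (k + 1))
      rw [mul_add, hk2] at h2
      rw [pow_succ] at h2 h3 ⊢
      refine (Nat.floor_eq_iff (by nlinarith)).2 ⟨?_, ?_⟩ <;> push_cast <;> linarith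
    have h2 : 2 ^ k ≤ 2 ^ (k + 1) - 1 := by
      have := Nat.one_le_two_pow (n := k)
      rw [pow_succ]
      lia
    rw [h1, min_eq_left h2, Nat.testBit_two_pow]
    simp only [Bool.true_and, decide_eq_decide]
    lia

theorem BoolCircuit.Computes.codeDigits (d p : ℕ) :
    Computes d (p * (d * 2)) (_root_.codeDigits d p) := by
  have h := flatMap (n := d) (s := (List.finRange d).length * 2) (List.range p)
    (H := fun j x => (List.finRange d).map fun i : Fin d => x.getD i false && decide (j = 0))
    fun j _ => by
      refine map _ fun i _ => ?_
      by_cases hj : j = 0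
      · simpa [hj] using (getD i.2).mono (by lia)
      · simpa [hj] using const d false
  rw [List.length_range, List.length_finRange] at h
  exact h

/-! ### Values of short bit strings -/

theorem binaryPoint_singleton_false (d : ℕ) : binaryPoint d [false] = 0 := by
  ext i
  simp only [binaryPoint, List.length_singleton, Finset.sum_range_one, PiLp.zero_apply]
  rw [if_neg]
  rcases h : 0 * d + (i : ℕ) with _ | k <;> simp

theorem binaryPoint_singleton_true (d : ℕ) :
    binaryPoint (d + 1) [true] = EuclideanSpace.single 0 (1 / 2 : ℝ) := by
  ext i
  simp only [binaryPoint, List.length_singleton, Finset.sum_range_one]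
  refine Fin.cases ?_ (fun i => ?_) i <;> simp

theorem binaryPoint_singleton_mem_unitCube (d : ℕ) (b : Bool) :
    binaryPoint d [b] ∈ unitCube d := by
  intro i
  simp only [binaryPoint, List.length_singleton, Finset.sum_range_one]
  split_ifs <;> constructor <;> norm_num

theorem binaryPoint_one_nil : binaryPoint 1 [] 0 = 0 := by
  simp [binaryPoint]

theorem binaryPoint_one_cons (b : Bool) (s : List Bool) :
    binaryPoint 1 (b :: s) 0 = (if b then 1 / 2 else 0) + binaryPoint 1 s 0 / 2 := by
  simp only [binaryPoint, List.length_cons, Finset.sum_range_succ', Finset.sum_div]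
  rw [add_comm]
  congr 1
  · simp
  · refine Finset.sum_congr rfl fun j _ => ?_
    simp only [mul_one, Fin.val_zero, add_zero, List.getD_cons_succ]
    split_ifs
    · rw [pow_succ]; ring
    · simp

theorem binaryPoint_one_mem (s : List Bool) : binaryPoint 1 s 0 ∈ Set.Ico (0 : ℝ) 1 := by
  induction s with
  | nil => simp [binaryPoint_one_nil]
  | cons b s ih =>
    rw [binaryPoint_one_cons]
    have := ih.1
    have := ih.2
    constructor <;> split_ifs <;> linarith

/-- A number in `[0, 1)` is at least `7/8` if and only if its first three binary digits are `1`. -/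
theorem seven_eighths_le_binaryPoint_iff (s : List Bool) :
    7 / 8 ≤ binaryPoint 1 s 0 ↔
      (s.getD 0 false && (s.getD 1 false && s.getD 2 false)) = true := by
  rcases s with _ | ⟨a, _ | ⟨b, _ | ⟨c, s⟩⟩⟩
  · simp only [binaryPoint_one_nil]
    norm_num
  · simp only [binaryPoint_one_nil, binaryPoint_one_cons]
    cases a <;> norm_num
  · simp only [binaryPoint_one_nil, binaryPoint_one_cons]
    cases a <;> cases b <;> norm_num
  -- The tail beyond three digits contributes less than `1/8`, so it cannot make up for a missing
  -- leading digit.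
  · have h := binaryPoint_one_mem s
    have h0 := h.1
    have h1 := h.2
    simp only [binaryPoint_one_cons, List.getD_cons_zero, List.getD_cons_succ]
    cases a <;> cases b <;> cases c <;>
      simp only [if_true, Bool.false_eq_true, if_false, Bool.and_false, Bool.and_true, iff_false,
        iff_true, not_le] <;> linarith

/-! ### The sequence of functions attached to a language -/

open Classical in
/-- The function that maps a point to the point that represents the membership bit of the bit
string encoded in its first digits. -/
noncomputable def membershipMap (L : Language Bool) (d : ℕ) (x : EuclideanSpace ℝ (Fin d)) :
    EuclideanSpace ℝ (Fin d) :=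
  binaryPoint d [decide (List.ofFn (codeWord x) ∈ L)]

theorem continuousOn_membershipMap (L : Language Bool) (d : ℕ) :
    ContinuousOn (membershipMap L d) (codeDomain d) := by
  classical
  exact (continuous_of_discreteTopology (f := fun w : Fin d → Bool =>
    binaryPoint d [decide (List.ofFn w ∈ L)])).comp_continuousOn (continuousOn_codeWord d)

theorem QCircuit.prob_mono (C : QCircuit) (x : List Bool) {S S' : Set (List Bool)} (h : S ⊆ S') :
    C.prob x S ≤ C.prob x S' :=
  Finset.sum_le_sum fun _ _ => Set.indicator_le_indicator_of_subset h (fun _ => by positivity) _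

theorem quantumEfficientlyApproximable_membershipMap {L : Language Bool} (hL : L ∈ BQP) :
    QuantumEfficientlyApproximable codeDomain (membershipMap L) := by
  obtain ⟨C, hC, hp⟩ := hL
  refine ⟨1, fun x => C x.1, hC.comp_fst, fun d m _ => ?_⟩
  refine ae_restrict_of_forall_mem (isCompact_codeDomain d).measurableSet fun x hx => ?_
  rw [Polynomial.eval_one, binaryDigits_one hx]
  have h := hp (List.ofFn (codeWord x))
  rw [List.length_ofFn] at h
  refine h.trans (QCircuit.prob_mono _ _ ?_)
  rintro _ rfl
  simp [membershipMap]

/-- The two possible values of the map are at distance `1/2`, and `exp (1/4) ≥ 1 + 1/4 + 1/32 >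
5/4`. The dimension is positive because in dimension `0` both values coincide. -/
theorem compositionKernel_membershipMap (L : Language Bool) (d : ℕ)
    (x y : EuclideanSpace ℝ (Fin (d + 1))) :
    ((List.ofFn (codeWord x) ∈ L ↔ List.ofFn (codeWord y) ∈ L) →
      compositionKernel (membershipMap L (d + 1)) x y = 1) ∧
    (¬(List.ofFn (codeWord x) ∈ L ↔ List.ofFn (codeWord y) ∈ L) →
      compositionKernel (membershipMap L (d + 1)) x y < 4 / 5) := by
  have hn : ‖binaryPoint (d + 1) [true]‖ ^ 2 = 1 / 4 := by
    rw [binaryPoint_singleton_true, PiLp.norm_single]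
    norm_num
  have he : Real.exp (-(1 / 4)) < 4 / 5 := by
    have h := Real.quadratic_le_exp_of_nonneg (by norm_num : (0 : ℝ) ≤ 1 / 4)
    rw [Real.exp_neg, inv_lt_comm₀ (Real.exp_pos _) (by norm_num)]
    linarith
  unfold compositionKernel membershipMap
  by_cases hx : List.ofFn (codeWord x) ∈ L <;> by_cases hy : List.ofFn (codeWord y) ∈ L <;>
    simp only [hx, hy, decide_true, decide_false, sub_self, sub_zero, zero_sub, norm_neg,
      binaryPoint_singleton_false, hn, he] <;> norm_num

/-- The decision whether a point of `[0, 1)`, given by its binary digits, is at least `7/8`. -/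
def leadingBits (s : List Bool) : Bool := s.getD 0 false && (s.getD 1 false && s.getD 2 false)

theorem BoolCircuit.Computes.leadingBits {n m s : ℕ} {F : List Bool → List Bool}
    (h : Computes n s F) (hm : ∀ x, x.length = n → (F x).length = m) :
    Computes n (s + 13) fun x => [_root_.leadingBits (F x)] := by
  -- Three `false` bits are appended to the output, so that the first three positions exist even if
  -- the output is shorter.
  have h3 : Computes (m + 3) 7 fun y => [_root_.leadingBits y] :=
    (getD (by lia)).and ((getD (by lia)).and (getD (by lia)))
  refine (h3.comp (h.append (const_list n (List.replicate 3 false)))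
    fun x hx => by simp [hm x hx]).congr fun x _ => ?_
  have hg : ∀ i, (F x ++ List.replicate 3 false).getD i false = (F x).getD i false := fun i => by
    rcases lt_or_ge i (F x).length with hi | hi
    · rw [List.getD_append _ _ _ _ hi]
    · rw [List.getD_append_right _ _ _ _ hi, List.getD_eq_default (F x) _ hi]
      rcases lt_or_ge (i - (F x).length) 3 with h | h
      · rw [List.getD_eq_getElem _ _ (by simpa using h), List.getElem_replicate]
      · exact List.getD_eq_default _ _ (by simpa using h)
  simp only [_root_.leadingBits, hg]

/-- A randomised circuit that approximates the kernel decides whether two bit strings agree with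
regard to membership in `L`. -/
theorem three_mul_card_wrong_le {L : Language Bool} {d p r : ℕ} {ε : ℝ} (hε : ε ≤ 1 / 20)
    {C : BoolCircuit}
    (h : ∀ᵐ z ∂((volume.restrict (codeDomain (d + 1))).prod
        (volume.restrict (codeDomain (d + 1)))),
      2 / 3 ≤ (Nat.card {ω : Fin r → Bool //
        |binaryPoint 1 (C.eval (binaryDigits p z.1 ++ binaryDigits p z.2 ++ List.ofFn ω)) 0
          - compositionKernel (membershipMap L (d + 1)) z.1 z.2| ≤ ε} : ℝ) / 2 ^ r)
    {b : Bool} (w w' : Fin (d + 1) → Bool) (hb : b = true ↔ (List.ofFn w ∈ L ↔ List.ofFn w' ∈ L)) :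
    3 * (Finset.univ.filter fun ω : Fin r → Bool =>
      (leadingBits (C.eval (codeDigits (d + 1) p (List.ofFn w) ++
        codeDigits (d + 1) p (List.ofFn w') ++ List.ofFn ω)) != b) = true).card ≤
      Fintype.card (Fin r → Bool) := by
  have hpos : ∀ w : Fin (d + 1) → Bool,
      (volume.restrict (codeDomain (d + 1))) (codeCell p w) ≠ 0 := fun w => by
    rw [Measure.restrict_apply (isOpen_codeCell p w).measurableSet,
      Set.inter_eq_left.2 (codeCell_subset p w)]
    exact ((isOpen_codeCell p w).measure_pos volume (codeCell_nonempty p w)).ne'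
  have hprod : ((volume.restrict (codeDomain (d + 1))).prod
      (volume.restrict (codeDomain (d + 1)))) (codeCell p w ×ˢ codeCell p w') ≠ 0 := by
    rw [Measure.prod_prod]
    exact mul_ne_zero (hpos w) (hpos w')
  obtain ⟨z, ⟨hz, hz'⟩, hgood⟩ : ∃ z ∈ codeCell p w ×ˢ codeCell p w',
      2 / 3 ≤ (Nat.card {ω : Fin r → Bool //
        |binaryPoint 1 (C.eval (binaryDigits p z.1 ++ binaryDigits p z.2 ++ List.ofFn ω)) 0
          - compositionKernel (membershipMap L (d + 1)) z.1 z.2| ≤ ε} : ℝ) / 2 ^ r := by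
    -- Otherwise the product of the two cells would be contained in the exceptional null set.
    by_contra! hcon
    refine hprod (measure_mono_null (fun z hz => ?_) (ae_iff.1 h))
    exact not_le.2 (hcon z hz)
  rw [binaryDigits_of_mem_codeCell hz, binaryDigits_of_mem_codeCell hz'] at hgood
  have hk := compositionKernel_membershipMap L d z.1 z.2
  rw [codeWord_eq hz, codeWord_eq hz', ← hb] at hk
  set K := compositionKernel (membershipMap L (d + 1)) z.1 z.2
  classical
  rw [Nat.card_eq_fintype_card, Fintype.card_subtype] at hgood
  set G := Finset.univ.filter fun ω : Fin r → Bool =>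
    |binaryPoint 1 (C.eval (codeDigits (d + 1) p (List.ofFn w) ++
        codeDigits (d + 1) p (List.ofFn w') ++ List.ofFn ω)) 0 - K| ≤ ε
  set B := Finset.univ.filter fun ω : Fin r → Bool =>
      (leadingBits (C.eval (codeDigits (d + 1) p (List.ofFn w) ++
        codeDigits (d + 1) p (List.ofFn w') ++ List.ofFn ω)) != b) = true
  -- The cut at `7/8` separates the cases: `1 - 1/20 ≥ 7/8` and `4/5 + 1/20 < 7/8`.
  have hdisj : Disjoint G B := by
    rw [Finset.disjoint_left]
    intro ω hG hB
    simp only [G, Finset.mem_filter, Finset.mem_univ, true_and] at hG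
    simp only [B, Finset.mem_filter, Finset.mem_univ, true_and, bne_iff_ne] at hB
    have h1 := abs_le.1 hG
    refine hB ?_
    have h2 := seven_eighths_le_binaryPoint_iff (C.eval (codeDigits (d + 1) p (List.ofFn w) ++
        codeDigits (d + 1) p (List.ofFn w') ++ List.ofFn ω))
    rw [← leadingBits] at h2
    rw [Bool.eq_iff_iff, ← h2]
    cases b
    · have := hk.2 (by simp)
      simp only [Bool.false_eq_true, iff_false, not_le]
      linarith [h1.2]
    · have := hk.1 rfl
      simp only [iff_true]
      linarith [h1.1]
  have hcard := Finset.card_le_univ (G ∪ B)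
  rw [Finset.card_union_of_disjoint hdisj] at hcard
  have hr : Fintype.card (Fin r → Bool) = 2 ^ r := by simp
  rw [hr] at hcard ⊢
  rw [le_div_iff₀ (by positivity)] at hgood
  have hcard' : (G.card : ℝ) + B.card ≤ 2 ^ r := by exact_mod_cast hcard
  have : 3 * (B.card : ℝ) ≤ 2 ^ r := by linarith
  exact_mod_cast this

open BoolCircuit in
-- Adleman's argument: the all-`false` word serves as the fixed second argument, and `12 (d + 2)`
-- random strings that give a correct majority for all `2^(d + 1)` words at once are hardwired.
theorem exists_circuit_of_approximation {L : Language Bool} {d p r : ℕ} {ε : ℝ} (hε : ε ≤ 1 / 20)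
    {C : BoolCircuit}
    (h : ∀ᵐ z ∂((volume.restrict (codeDomain (d + 1))).prod
        (volume.restrict (codeDomain (d + 1)))),
      2 / 3 ≤ (Nat.card {ω : Fin r → Bool //
        |binaryPoint 1 (C.eval (binaryDigits p z.1 ++ binaryDigits p z.2 ++ List.ofFn ω)) 0
          - compositionKernel (membershipMap L (d + 1)) z.1 z.2| ≤ ε} : ℝ) / 2 ^ r) :
    ∃ F : List Bool → Bool, (∀ x, x.length = d + 1 → (F x = true ↔ x ∈ L)) ∧
      Computes (d + 1) (12 * (d + 1 + 1) * (4 * p * (d + 1) + 2 * r + C.size + 14 +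
        (6 * (d + 1 + 1) + 1) * 7) + (6 * (d + 1 + 1) + 1) * 2 + 3) fun x => [F x] := by
  classical
  set w' : Fin (d + 1) → Bool := fun _ => false
  set vote : List Bool → (Fin r → Bool) → Bool := fun x ω =>
    leadingBits (C.eval (codeDigits (d + 1) p x ++
        (codeDigits (d + 1) p (List.ofFn w') ++ List.ofFn ω))) with hvote
  obtain ⟨l, hl, hlt⟩ := exists_list_countP_lt (W := Fin (d + 1) → Bool) (d := d + 1) (by simp)
    (fun w ω => vote (List.ofFn w) ω !=
      decide (List.ofFn w ∈ L ↔ List.ofFn w' ∈ L)) fun w => by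
    simp only [hvote, ← List.append_assoc]
    exact three_mul_card_wrong_le hε h w w' (by simp)
  have hc : ∀ f ∈ l.map fun ω x => vote x ω, Computes (d + 1)
      (4 * p * (d + 1) + 2 * r + C.size + 14) fun x => [f x] := by
    simp only [List.mem_map]
    rintro _ ⟨ω, -, rfl⟩
    have h1 := (Computes.codeDigits (d + 1) p).append (Computes.const_list (d + 1)
      (codeDigits (d + 1) p (List.ofFn w') ++ List.ofFn ω))
    have h2 := (Computes.of_circuit C _).comp h1 fun x _ => by
      rw [List.length_append, length_codeDigits]
    refine (h2.leadingBits (m := C.outputs.length) fun x _ => by simp [eval]).mono ?_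
    rw [List.length_append, length_codeDigits, List.length_ofFn]
    lia
  have ht := Computes.threshold hc (6 * (d + 1 + 1))
  rw [List.length_map, hl] at ht
  have hcorrect : ∀ x : List Bool, x.length = d + 1 →
      decide (6 * (d + 1 + 1) ≤ (l.map fun ω x => vote x ω).countP fun f => f x) =
        decide (x ∈ L ↔ List.ofFn w' ∈ L) := by
    intro x hx
    obtain ⟨w, rfl⟩ : ∃ w : Fin (d + 1) → Bool, x = List.ofFn w :=
      ⟨fun i => x.getD i false, List.ext_getElem (by simp [hx]) fun i h1 _ => by
        rw [List.getElem_ofFn, List.getD_eq_getElem _ _ h1]⟩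
    rw [List.countP_map]
    exact decide_le_countP_eq (by rw [hl]; lia) (hlt w)
  -- The vote decides agreement with the reference word. Whether that word is in `L` is one bit of
  -- advice, which tells whether to negate the vote.
  by_cases hw' : List.ofFn w' ∈ L
  · refine ⟨fun x => decide (6 * (d + 1 + 1) ≤ (l.map fun ω x => vote x ω).countP fun f => f x),
      fun x hx => ?_, ht.mono (by lia)⟩
    beta_reduce
    rw [hcorrect x hx]
    simp [hw', -List.ofFn_succ]
  · refine ⟨fun x => !decide (6 * (d + 1 + 1) ≤ (l.map fun ω x => vote x ω).countP fun f => f x),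
      fun x hx => ?_, ht.not.mono (by lia)⟩
    beta_reduce
    rw [hcorrect x hx]
    simp [hw', -List.ofFn_succ]

open BoolCircuit in
theorem mem_PPoly_of_approximable {L : Language Bool} {ε : ℝ} (hε : ε ≤ 1 / 20)
    (h : ClassicallyEfficientlyApproximable ε codeDomain
      fun d => compositionKernel (membershipMap L d)) : L ∈ PPoly := by
  classical
  obtain ⟨q, hq⟩ := h
  refine ⟨12 * (.X + 1) * (4 * q * .X + 2 * q + q + 14 + (6 * (.X + 1) + 1) * 7) +
    (6 * (.X + 1) + 1) * 2 + 3, fun n => ?_⟩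
  simp only [Polynomial.eval_add, Polynomial.eval_mul, Polynomial.eval_X, Polynomial.eval_one,
    Polynomial.eval_ofNat]
  cases n with
  | zero =>
    -- In dimension `0` the kernel carries no information, but there is only the empty word, so a
    -- constant circuit suffices.
    obtain ⟨C, hC, -, h⟩ := Computes.const 0 (decide ([] ∈ L))
    refine ⟨C, hC.trans (by lia), fun x hx => ?_⟩
    rw [List.length_eq_zero_iff.1 hx]
    convert h [] rfl
  | succ d =>
    obtain ⟨p, r, C, hp, hr, hC, h⟩ := hq (d + 1)
    obtain ⟨F, hF, D, hD, -, hDF⟩ := exists_circuit_of_approximation hε h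
    refine ⟨D, hD.trans ?_, fun x hx => ?_⟩
    · gcongr
    · have hFx : F x = decide (x ∈ L) := by
        rw [Bool.eq_iff_iff, hF x hx, decide_eq_true_eq]
      rw [hDF x hx]
      beta_reduce
      rw [hFx]

theorem proposition2 (hBQP : ¬ BQP ⊆ PPoly) :
    ∃ (X : ∀ d : ℕ, Set (EuclideanSpace ℝ (Fin d)))
      (f : ∀ d : ℕ, EuclideanSpace ℝ (Fin d) → EuclideanSpace ℝ (Fin d)),
      (∀ d : ℕ, IsCompact (X d) ∧ (interior (X d)).Nonempty ∧ X d ⊆ unitCube d ∧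
        ContinuousOn (f d) (X d) ∧ Set.MapsTo (f d) (X d) (unitCube d)) ∧
      QuantumEfficientlyApproximable X f ∧
      ∃ ε₀ : ℝ, 0 < ε₀ ∧ ∀ ε : ℝ, 0 < ε → ε ≤ ε₀ →
        ¬ ClassicallyEfficientlyApproximable ε X (fun d => compositionKernel (f d)) := by
  obtain ⟨L, hL, hL'⟩ := Set.not_subset.1 hBQP
  exact ⟨codeDomain, membershipMap L, fun d => ⟨isCompact_codeDomain d,
    interior_codeDomain_nonempty d, codeDomain_subset d, continuousOn_membershipMap L d,
    fun x _ => binaryPoint_singleton_mem_unitCube d _⟩,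
    quantumEfficientlyApproximable_membershipMap hL,
    1 / 20, by norm_num, fun ε _ hε h => hL' (mem_PPoly_of_approximable hε h)⟩
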